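/- Let $m_1,m_2\ge 1$, $m=m_1+m_2$, $j=\mathrm{diag}(I_{m_1},-I_{m_2})$. A Dirac system on the interval $0\le k\le r$ ($r\in\mathbb N_0$) is $$y_{k+1}(z)=(I_m+\mathrm i z\,jC_k)\,y_k(z),\qquad 0\le k\le r,$$ where the potential $\{C_k\}_{k=0}^r$ consists of complex $m\times m$ matrices that are positive definite and $j$-unitary: $C_k>0$, $C_kjC_k=j$. Let $W_k$ be its fundamental solution, normalized by $W_0(z)=I_m$. A Weyl function of the system on $0\le k\le r$ is an $m_2\times m_1$ matrix function $\varphi$ on the open upper half-plane $\mathbb C_+$ of the form $$\varphi(z)=-\begin{bmatrix}0&I_{m_2}\end{bmatrix}W_{r+1}(\overline z)^*\mathcal P(z)\Big(\begin{bmatrix}I_{m_1}&0\end{bmatrix}W_{r+1}(\overline z)^*\mathcal P(z)\Big)^{-1}$$ (an equality of meromorphic functions, i.e. off a discrete subset of $\mathbb C_+$), where $\mathcal P$ is an $m\times m_1$ matrix function, meromorphic in $\mathbb C_+$, such that $\mathcal P(z)^*\mathcal P(z)>0$ and $\mathcal P(z)^*j\mathcal P(z)\ge 0$ for all $z\in\mathbb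 C_+$ outside a discrete subset of $\mathbb C_+$, and such that $\mathcal P$ has no pole at $\mathrm i$ and $\mathcal P(\mathrm i)^*\mathcal P(\mathrm i)>0$. Let $\varphi$ and $\widetilde\varphi$ be Weyl functions of two Dirac systems (with the same $m_1,m_2$) with positive definite and $j$-unitary potentials $\{C_k\}$ and $\{\widetilde C_k\}$, given on the intervals $0\le k\le r$ and $0\le k\le\widetilde r$, respectively. Let $p\in\mathbb N_0$, $p\le\min(r,\widetilde r)$, and assume that $$\varphi\Big(\mathrm i\,\frac{1-z}{1+z}\Big)-\widetilde\varphi\Big(\mathrm i\,\frac{1-z}{1+z}\Big)=O(z^{p+1}),\qquad z\to 0,\ z\neq 0.$$ Then $C_k=\widetilde C_k$ for all $0\le k\le p$. -/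

import Mathlib

open Filter Topology Matrix
open scoped ComplexOrder

namespace DiscreteDirac

/-- The signature matrix `j = diag (I_{m₁}, -I_{m₂})`. -/
def sig (m₁ m₂ : ℕ) : Matrix (Fin m₁ ⊕ Fin m₂) (Fin m₁ ⊕ Fin m₂) ℂ :=
  Matrix.fromBlocks 1 0 0 (-1)

/-- The normalized fundamental solution of the Dirac system
`y_{k+1}(z) = (I + i z j C_k) y_k(z)`, with `W_0(z) = I`.
The matrix `W_k(z)` involves `C_0, …, C_{k-1}` only. -/
noncomputable def fundSol {m₁ m₂ : ℕ}
    (C : ℕ → Matrix (Fin m₁ ⊕ Fin m₂) (Fin m₁ ⊕ Fin m₂) ℂ) :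
    ℕ → ℂ → Matrix (Fin m₁ ⊕ Fin m₂) (Fin m₁ ⊕ Fin m₂) ℂ
  | 0, _ => 1
  | k + 1, z => (1 + (Complex.I * z) • (sig m₁ m₂ * C k)) * fundSol C k z

/-- The open upper half-plane. -/
def upperHalf : Set ℂ := {z : ℂ | 0 < z.im}

/-- The potential `{C_k}` is positive (definite) and `j`-unitary on the interval `0 ≤ k ≤ r`. -/
def IsPotential {m₁ m₂ : ℕ} (r : ℕ)
    (C : ℕ → Matrix (Fin m₁ ⊕ Fin m₂) (Fin m₁ ⊕ Fin m₂) ℂ) : Prop :=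
  ∀ k ≤ r, (C k).PosDef ∧ C k * sig m₁ m₂ * C k = sig m₁ m₂

/-- Admissible parameter matrices: `m × m₁` matrix functions, meromorphic in the upper half-plane,
which off a discrete subset of the half-plane are nonsingular (`P* P > 0`) and have
property-`j` (`P* j P ≥ 0`), and which are well-defined (have no pole) and
nonsingular at `z = i`. -/
structure IsParameter {m₁ m₂ : ℕ}
    (P : ℂ → Matrix (Fin m₁ ⊕ Fin m₂) (Fin m₁) ℂ) : Prop where
  meromorphic : ∀ a b, MeromorphicOn (fun z => P z a b) upperHalf
  nonsingular : ∀ᶠ z in codiscreteWithin upperHalf, ((P z)ᴴ * P z).PosDef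
  property_j : ∀ᶠ z in codiscreteWithin upperHalf, ((P z)ᴴ * sig m₁ m₂ * P z).PosSemidef
  analyticAt_I : ∀ a b, AnalyticAt ℂ (fun z => P z a b) Complex.I
  nonsingular_I : ((P Complex.I)ᴴ * P Complex.I).PosDef

/-- The linear-fractional transformation
`φ(z, P) = -[0 I] W_{r+1}(z̄)* P(z) ([I 0] W_{r+1}(z̄)* P(z))⁻¹`. Here `toRows₁` and `toRows₂`
pick the upper `m₁` and the lower `m₂` rows. -/
noncomputable def weylTransform {m₁ m₂ : ℕ} (r : ℕ)
    (C : ℕ → Matrix (Fin m₁ ⊕ Fin m₂) (Fin m₁ ⊕ Fin m₂) ℂ)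
    (P : ℂ → Matrix (Fin m₁ ⊕ Fin m₂) (Fin m₁) ℂ) (z : ℂ) : Matrix (Fin m₂) (Fin m₁) ℂ :=
  -(((fundSol C (r + 1) (starRingEnd ℂ z))ᴴ * P z).toRows₂ *
    (((fundSol C (r + 1) (starRingEnd ℂ z))ᴴ * P z).toRows₁)⁻¹)

/-- `φ` is a Weyl function of the Dirac system with potential `C` on the interval `0 ≤ k ≤ r`:
it is of the form `φ(z, P)` with an admissible `P`. As usual for meromorphic functions, the
equality is one of meromorphic functions in the upper half-plane, that is, it is required off a
discrete subset of the half-plane (poles of `P`, zeros of the denominator). -/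
def IsWeylFunction {m₁ m₂ : ℕ} (r : ℕ)
    (C : ℕ → Matrix (Fin m₁ ⊕ Fin m₂) (Fin m₁ ⊕ Fin m₂) ℂ)
    (φ : ℂ → Matrix (Fin m₂) (Fin m₁) ℂ) : Prop :=
  ∃ P : ℂ → Matrix (Fin m₁ ⊕ Fin m₂) (Fin m₁) ℂ, IsParameter P ∧
    ∀ᶠ z in codiscreteWithin upperHalf, φ z = weylTransform r C P z

end DiscreteDirac

namespace DiscreteDirac

variable {m₁ m₂ : ℕ}

/-! Write `Y(z) = W_{r+1}(z̄)* P(z) = (1 - iz C₀j)(1 - iz C₁j) ⋯ P(z)`. Since `(C_k j)² = 1`, at `z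
= i` each factor `1 + C_k j` is twice the projection onto the eigenspace of `C_k j` for the
eigenvalue `1`. Positivity of `C_k` makes that eigenspace `j`-positive and the one for `-1`
`j`-negative, so a factor is injective on a `j`-nonnegative subspace. By the dimension bound `m₁`
for such subspaces, the columns of `Y(i)` span the whole `1`-eigenspace of `C₀j`, and this
eigenspace determines `C₀` (`eq_of_common_frame`).

Closeness of `φ` and `φ'` to order `w ^ (p + 1)` in the Cayley variable `w` means `Y' - Y A = O(w ^
(p + 1))` with `A` convergent (`sub_mul_eq_fromRows_mul`). The limit `w → 0` gives `C₀ = C'₀`.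
Multiplying by `1 + iz C₀j` then strips the first factor from both products, leaving the scalar `1 +
z²`, which has a simple zero at `w = 0`. Each stripped factor thus costs one order of `w`, and
induction on `p` (`potential_eq_of_isBigO`) finishes. -/

theorem sig_isHermitian : (sig m₁ m₂)ᴴ = sig m₁ m₂ := by
  simp [sig, Matrix.fromBlocks_conjTranspose]

theorem sig_mul_sig : sig m₁ m₂ * sig m₁ m₂ = 1 := by
  simp [sig, Matrix.fromBlocks_multiply]

theorem star_dotProduct_sig_mulVec (u v : Fin m₁ ⊕ Fin m₂ → ℂ) :
    star u ⬝ᵥ (sig m₁ m₂ *ᵥ v) = star (sig m₁ m₂ *ᵥ u) ⬝ᵥ v := by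
  rw [star_mulVec, sig_isHermitian, dotProduct_mulVec]

theorem star_dotProduct_sig_mulVec_self (v : Fin m₁ ⊕ Fin m₂ → ℂ) :
    star v ⬝ᵥ (sig m₁ m₂ *ᵥ v) =
      star (v ∘ Sum.inl) ⬝ᵥ (v ∘ Sum.inl) - star (v ∘ Sum.inr) ⬝ᵥ (v ∘ Sum.inr) := by
  have h : sig m₁ m₂ *ᵥ v = Sum.elim (v ∘ Sum.inl) (-(v ∘ Sum.inr)) := by
    simp [sig, fromBlocks_mulVec, neg_mulVec]
  rw [h]
  simp [dotProduct, Fintype.sum_sum_type, sub_eq_add_neg]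

/-- A `j`-nonnegative vector with vanishing upper part is zero. -/
theorem eq_zero_of_sig_nonneg {v : Fin m₁ ⊕ Fin m₂ → ℂ}
    (hv : 0 ≤ star v ⬝ᵥ (sig m₁ m₂ *ᵥ v)) (h : v ∘ Sum.inl = 0) : v = 0 := by
  rw [star_dotProduct_sig_mulVec_self, h] at hv
  simp only [star_zero, dotProduct_zero, zero_sub, Left.nonneg_neg_iff] at hv
  have h2 : v ∘ Sum.inr = 0 :=
    dotProduct_star_self_eq_zero.mp (le_antisymm hv (dotProduct_star_self_nonneg _))
  ext (i | i)
  · exact congrFun h i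
  · exact congrFun h2 i

/-! ### Eigenspaces of `C j` and `j`-nonnegative frames -/

section Potential

variable {C : Matrix (Fin m₁ ⊕ Fin m₂) (Fin m₁ ⊕ Fin m₂) ℂ}

theorem mul_sig_mul_self (hj : C * sig m₁ m₂ * C = sig m₁ m₂) :
    (C * sig m₁ m₂) * (C * sig m₁ m₂) = 1 := by
  rw [← mul_assoc, hj, sig_mul_sig]

theorem mul_one_add_mul_sig (hj : C * sig m₁ m₂ * C = sig m₁ m₂) :
    C * sig m₁ m₂ * (1 + C * sig m₁ m₂) = 1 + C * sig m₁ m₂ := by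
  rw [mul_add, mul_sig_mul_self hj, mul_one, add_comm]

theorem sig_mulVec_ne_zero {v : Fin m₁ ⊕ Fin m₂ → ℂ} (hv : v ≠ 0) : sig m₁ m₂ *ᵥ v ≠ 0 := by
  intro h
  apply hv
  rw [← one_mulVec v, ← sig_mul_sig, ← mulVec_mulVec, h, mulVec_zero]

/-- When `C j v = v`, the positive form of `C` evaluated at `j v` equals `v* j v`. -/
theorem sig_pos_of_mulVec_eq (hC : C.PosDef) {v : Fin m₁ ⊕ Fin m₂ → ℂ}
    (h : (C * sig m₁ m₂) *ᵥ v = v) (hv : v ≠ 0) : 0 < star v ⬝ᵥ (sig m₁ m₂ *ᵥ v) := by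
  have h1 := hC.dotProduct_mulVec_pos (sig_mulVec_ne_zero hv)
  rwa [mulVec_mulVec, h, ← star_dotProduct_sig_mulVec] at h1

theorem sig_neg_of_mulVec_eq_neg (hC : C.PosDef) {v : Fin m₁ ⊕ Fin m₂ → ℂ}
    (h : (C * sig m₁ m₂) *ᵥ v = -v) (hv : v ≠ 0) : star v ⬝ᵥ (sig m₁ m₂ *ᵥ v) < 0 := by
  have h1 := hC.dotProduct_mulVec_pos (sig_mulVec_ne_zero hv)
  rw [mulVec_mulVec, h, dotProduct_neg, ← star_dotProduct_sig_mulVec] at h1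
  exact neg_pos.mp h1

end Potential

/-- The columns of `M` are linearly independent and span a `j`-nonnegative subspace. -/
def IsNonnegFrame (M : Matrix (Fin m₁ ⊕ Fin m₂) (Fin m₁) ℂ) : Prop :=
  ∀ x, x ≠ 0 → M *ᵥ x ≠ 0 ∧ 0 ≤ star (M *ᵥ x) ⬝ᵥ (sig m₁ m₂ *ᵥ (M *ᵥ x))

theorem IsNonnegFrame.isUnit_toRows₁ {M : Matrix (Fin m₁ ⊕ Fin m₂) (Fin m₁) ℂ}
    (hM : IsNonnegFrame M) : IsUnit M.toRows₁ := by
  rw [isUnit_iff_isUnit_det, isUnit_iff_ne_zero]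
  intro h
  obtain ⟨x, hx, h0⟩ := exists_mulVec_eq_zero_iff.mpr h
  exact (hM x hx).1 (eq_zero_of_sig_nonneg (hM x hx).2 h0)

/-- The range of `1 + C j` is fixed by `C j`, hence `j`-positive away from `0`. A nonzero vector
killed by `1 + C j` would be `j`-negative, so it cannot lie in the span of `M`. -/
theorem IsNonnegFrame.mul {M : Matrix (Fin m₁ ⊕ Fin m₂) (Fin m₁) ℂ} (hM : IsNonnegFrame M)
    {C : Matrix (Fin m₁ ⊕ Fin m₂) (Fin m₁ ⊕ Fin m₂) ℂ} (hC : C.PosDef)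
    (hj : C * sig m₁ m₂ * C = sig m₁ m₂) : IsNonnegFrame ((1 + C * sig m₁ m₂) * M) := by
  intro x hx
  have hfix : (C * sig m₁ m₂) *ᵥ (((1 + C * sig m₁ m₂) * M) *ᵥ x) =
      ((1 + C * sig m₁ m₂) * M) *ᵥ x := by
    rw [mulVec_mulVec, ← Matrix.mul_assoc, mul_one_add_mul_sig hj]
  have hne : ((1 + C * sig m₁ m₂) * M) *ᵥ x ≠ 0 := by
    intro h
    rw [← mulVec_mulVec, add_mulVec, one_mulVec] at h
    exact (sig_neg_of_mulVec_eq_neg hC (eq_neg_of_add_eq_zero_right h) (hM x hx).1).not_ge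
      (hM x hx).2
  exact ⟨hne, (sig_pos_of_mulVec_eq hC hfix hne).le⟩

/-- A frame fixed by `C j` spans the whole eigenspace of `C j` for the eigenvalue `1`. -/
theorem exists_mulVec_eq_of_fixed {C : Matrix (Fin m₁ ⊕ Fin m₂) (Fin m₁ ⊕ Fin m₂) ℂ}
    (hC : C.PosDef) {Y : Matrix (Fin m₁ ⊕ Fin m₂) (Fin m₁) ℂ} (hY : IsNonnegFrame Y)
    (hfix : C * sig m₁ m₂ * Y = Y) {v : Fin m₁ ⊕ Fin m₂ → ℂ}
    (hv : (C * sig m₁ m₂) *ᵥ v = v) : ∃ x, v = Y *ᵥ x := by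
  refine ⟨Y.toRows₁⁻¹ *ᵥ (v ∘ Sum.inl), ?_⟩
  set x := Y.toRows₁⁻¹ *ᵥ (v ∘ Sum.inl) with hx
  have htop : (v - Y *ᵥ x) ∘ Sum.inl = 0 := by
    have : Y.toRows₁ *ᵥ x = v ∘ Sum.inl := by
      rw [hx, mulVec_mulVec, mul_nonsing_inv _ ((isUnit_iff_isUnit_det _).mp hY.isUnit_toRows₁),
        one_mulVec]
    ext i
    have hi := congrFun this i
    simp only [Function.comp_apply, Pi.sub_apply, Pi.zero_apply]
    rw [sub_eq_zero]
    exact hi.symm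
  -- The difference is again fixed by `C j`, so it is `j`-positive unless zero; its vanishing upper
  -- part excludes the former.
  have hw : (C * sig m₁ m₂) *ᵥ (v - Y *ᵥ x) = v - Y *ᵥ x := by
    rw [mulVec_sub, hv, mulVec_mulVec, hfix]
  by_contra hne
  have hne' : v - Y *ᵥ x ≠ 0 := sub_ne_zero.mpr hne
  exact hne' (eq_zero_of_sig_nonneg (sig_pos_of_mulVec_eq hC hw hne').le htop)

theorem fixed_mul_eq {C D : Matrix (Fin m₁ ⊕ Fin m₂) (Fin m₁ ⊕ Fin m₂) ℂ}
    (hC : C.PosDef) (hj : C * sig m₁ m₂ * C = sig m₁ m₂)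
    {Y : Matrix (Fin m₁ ⊕ Fin m₂) (Fin m₁) ℂ} (hY : IsNonnegFrame Y)
    (hCY : C * sig m₁ m₂ * Y = Y) (hDY : D * sig m₁ m₂ * Y = Y) :
    D * sig m₁ m₂ * (1 + C * sig m₁ m₂) = 1 + C * sig m₁ m₂ := by
  refine Matrix.ext_of_mulVec_single fun i => ?_
  obtain ⟨x, hx⟩ := exists_mulVec_eq_of_fixed hC hY hCY
    (v := (1 + C * sig m₁ m₂) *ᵥ Pi.single i 1) (by
      rw [mulVec_mulVec, mul_one_add_mul_sig hj])
  rw [← mulVec_mulVec, hx, mulVec_mulVec, hDY]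

/-- A positive definite `j`-unitary matrix `C` is determined by the eigenspace of `C j` for the
eigenvalue `1`. -/
theorem eq_of_common_frame {C D : Matrix (Fin m₁ ⊕ Fin m₂) (Fin m₁ ⊕ Fin m₂) ℂ}
    (hC : C.PosDef) (hjC : C * sig m₁ m₂ * C = sig m₁ m₂)
    (hD : D.PosDef) (hjD : D * sig m₁ m₂ * D = sig m₁ m₂)
    {Y : Matrix (Fin m₁ ⊕ Fin m₂) (Fin m₁) ℂ} (hY : IsNonnegFrame Y)
    (hCY : C * sig m₁ m₂ * Y = Y) (hDY : D * sig m₁ m₂ * Y = Y) : C = D := by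
  have key : ∀ {A B : Matrix (Fin m₁ ⊕ Fin m₂) (Fin m₁ ⊕ Fin m₂) ℂ},
      B * sig m₁ m₂ * (1 + A * sig m₁ m₂) = 1 + A * sig m₁ m₂ →
      B * sig m₁ m₂ * A = sig m₁ m₂ + A - B := by
    intro A B h
    have h2 := congrArg (· * sig m₁ m₂) h
    simp only [mul_add, add_mul, mul_one, one_mul, mul_assoc, sig_mul_sig] at h2
    rw [eq_sub_iff_add_eq, mul_assoc, add_comm, h2]
  have h1 := key (fixed_mul_eq hC hjC hY hCY hDY)
  have h2 := key (fixed_mul_eq hD hjD hY hDY hCY)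
  -- The adjoint of `D j C = j + C - D` is `C j D = j + C - D`, while exchanging the roles gives `C
  -- j D = j + D - C`.
  have h3 := congrArg conjTranspose h1
  simp only [conjTranspose_mul, conjTranspose_add, conjTranspose_sub, sig_isHermitian,
    hC.isHermitian.eq, hD.isHermitian.eq, ← mul_assoc] at h3
  rw [h2] at h3
  refine Matrix.ext fun i k => ?_
  have h4 := congrFun (congrFun h3 i) k
  simp only [Matrix.add_apply, Matrix.sub_apply] at h4
  linear_combination -h4 / 2

/-- The matrix function `W_n(z̄)*`. -/
noncomputable def adjSol (C : ℕ → Matrix (Fin m₁ ⊕ Fin m₂) (Fin m₁ ⊕ Fin m₂) ℂ) (n : ℕ) (z : ℂ) :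
    Matrix (Fin m₁ ⊕ Fin m₂) (Fin m₁ ⊕ Fin m₂) ℂ :=
  (fundSol C n (starRingEnd ℂ z))ᴴ

/-! ### Factorization of `W_n(z̄)*` -/

theorem fundSol_succ' (C : ℕ → Matrix (Fin m₁ ⊕ Fin m₂) (Fin m₁ ⊕ Fin m₂) ℂ) (n : ℕ) (z : ℂ) :
    fundSol C (n + 1) z =
      fundSol (fun k => C (k + 1)) n z * (1 + (Complex.I * z) • (sig m₁ m₂ * C 0)) := by
  induction n with
  | zero => simp [fundSol]
  | succ n ih => rw [fundSol, ih, fundSol, mul_assoc]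

theorem adjSol_zero (C : ℕ → Matrix (Fin m₁ ⊕ Fin m₂) (Fin m₁ ⊕ Fin m₂) ℂ) (z : ℂ) :
    adjSol C 0 z = 1 := by
  simp [adjSol, fundSol]

theorem adjSol_succ {C : ℕ → Matrix (Fin m₁ ⊕ Fin m₂) (Fin m₁ ⊕ Fin m₂) ℂ}
    (hC : (C 0).PosDef) (n : ℕ) (z : ℂ) :
    adjSol C (n + 1) z =
      (1 + (-(Complex.I * z)) • (C 0 * sig m₁ m₂)) * adjSol (fun k => C (k + 1)) n z := by
  simp [adjSol, fundSol_succ', conjTranspose_mul, sig_isHermitian, hC.isHermitian.eq]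

theorem continuous_fundSol (C : ℕ → Matrix (Fin m₁ ⊕ Fin m₂) (Fin m₁ ⊕ Fin m₂) ℂ) (n : ℕ) :
    Continuous (fundSol C n) := by
  induction n with
  | zero => exact continuous_const
  | succ n ih =>
    have : Continuous fun z : ℂ => 1 + (Complex.I * z) • (sig m₁ m₂ * C n) := by fun_prop
    exact this.matrix_mul ih

theorem continuous_adjSol (C : ℕ → Matrix (Fin m₁ ⊕ Fin m₂) (Fin m₁ ⊕ Fin m₂) ℂ) (n : ℕ) :
    Continuous (adjSol C n) :=
  ((continuous_fundSol C n).comp Complex.continuous_conj).matrix_conjTranspose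

theorem IsPotential.tail {r : ℕ} {C : ℕ → Matrix (Fin m₁ ⊕ Fin m₂) (Fin m₁ ⊕ Fin m₂) ℂ}
    (hC : IsPotential (r + 1) C) : IsPotential r fun k => C (k + 1) :=
  fun k hk => hC (k + 1) (by omega)

theorem adjSol_I_succ {C : ℕ → Matrix (Fin m₁ ⊕ Fin m₂) (Fin m₁ ⊕ Fin m₂) ℂ}
    (hC : (C 0).PosDef) (n : ℕ) :
    adjSol C (n + 1) Complex.I =
      (1 + C 0 * sig m₁ m₂) * adjSol (fun k => C (k + 1)) n Complex.I := by
  simp [adjSol_succ hC]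

theorem IsNonnegFrame.adjSol_mul {M : Matrix (Fin m₁ ⊕ Fin m₂) (Fin m₁) ℂ} (hM : IsNonnegFrame M)
    {n : ℕ} : ∀ {C : ℕ → Matrix (Fin m₁ ⊕ Fin m₂) (Fin m₁ ⊕ Fin m₂) ℂ},
    (∀ k < n, (C k).PosDef ∧ C k * sig m₁ m₂ * C k = sig m₁ m₂) →
    IsNonnegFrame (adjSol C n Complex.I * M) := by
  induction n with
  | zero => intro C _; rwa [adjSol_zero, Matrix.one_mul]
  | succ n ih =>
    intro C hC
    have h0 := hC 0 (by omega)
    rw [adjSol_I_succ h0.1, Matrix.mul_assoc]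
    exact (ih fun k hk => hC (k + 1) (by omega)).mul h0.1 h0.2

/-- The Cayley transform mapping `0` to the imaginary unit. -/
noncomputable def cayley (w : ℂ) : ℂ := Complex.I * ((1 - w) / (1 + w))

/-! ### The Cayley transform near `0` -/

theorem cayley_zero : cayley 0 = Complex.I := by simp [cayley]

theorem one_add_ne_zero_eventually : ∀ᶠ w : ℂ in 𝓝 0, 1 + w ≠ 0 := by
  have : ContinuousAt (fun w : ℂ => 1 + w) 0 := by fun_prop
  exact this.eventually_ne (by simp)

theorem tendsto_cayley : Tendsto cayley (𝓝[≠] 0) (𝓝 Complex.I) := by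
  have : ContinuousAt cayley 0 := by
    unfold cayley
    fun_prop (disch := simp)
  have h := this.tendsto
  rw [cayley_zero] at h
  exact h.mono_left nhdsWithin_le_nhds

theorem tendsto_cayley_nhdsNE : Tendsto cayley (𝓝[≠] 0) (𝓝[≠] Complex.I) := by
  refine tendsto_nhdsWithin_iff.mpr ⟨tendsto_cayley, ?_⟩
  filter_upwards [self_mem_nhdsWithin, nhdsWithin_le_nhds one_add_ne_zero_eventually] with w hw h1 h
  apply hw
  have h2 : Complex.I * ((1 - w) / (1 + w)) = Complex.I * 1 := by rw [mul_one]; exact h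
  have h3 := mul_left_cancel₀ Complex.I_ne_zero h2
  rw [div_eq_iff h1] at h3
  simp only [Set.mem_singleton_iff]
  linear_combination -h3 / 2

/-! ### Entrywise estimates and limits of matrix functions -/

section Asymptotics

variable {l m n : Type*}

theorem isBigO_one_entry {F : Filter ℂ} {B : ℂ → Matrix l m ℂ} {B₀ : Matrix l m ℂ}
    (hB : Tendsto B F (𝓝 B₀)) (a : l) (b : m) :
    (fun w => B w a b) =O[F] fun _ => (1 : ℂ) :=
  (tendsto_pi_nhds.mp (tendsto_pi_nhds.mp hB a) b).isBigO_one ℂ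

variable [Fintype m]

theorem isBigO_mul_of_tendsto_left {F : Filter ℂ} {B : ℂ → Matrix l m ℂ} {B₀ : Matrix l m ℂ}
    (hB : Tendsto B F (𝓝 B₀)) {E : ℂ → Matrix m n ℂ} {g : ℂ → ℂ}
    (hE : ∀ a b, (fun w => E w a b) =O[F] g) (a : l) (b : n) :
    (fun w => (B w * E w) a b) =O[F] g := by
  simp only [Matrix.mul_apply]
  have h : ∀ c ∈ Finset.univ, (fun w => B w a c * E w c b) =O[F] g := fun c _ => by
    simpa using (isBigO_one_entry hB a c).mul (hE c b)
  exact Asymptotics.IsBigO.fun_sum h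

theorem isBigO_mul_of_tendsto_right {F : Filter ℂ} {B : ℂ → Matrix m n ℂ} {B₀ : Matrix m n ℂ}
    (hB : Tendsto B F (𝓝 B₀)) {E : ℂ → Matrix l m ℂ} {g : ℂ → ℂ}
    (hE : ∀ a b, (fun w => E w a b) =O[F] g) (a : l) (b : n) :
    (fun w => (E w * B w) a b) =O[F] g := by
  simp only [Matrix.mul_apply]
  have h : ∀ c ∈ Finset.univ, (fun w => E w a c * B w c b) =O[F] g := fun c _ => by
    simpa using (hE a c).mul (isBigO_one_entry hB c b)
  exact Asymptotics.IsBigO.fun_sum h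

theorem tendsto_matrix_mul {α : Type*} {F : Filter α} {A : α → Matrix l m ℂ} {A₀ : Matrix l m ℂ}
    {B : α → Matrix m n ℂ} {B₀ : Matrix m n ℂ} (hA : Tendsto A F (𝓝 A₀))
    (hB : Tendsto B F (𝓝 B₀)) : Tendsto (fun w => A w * B w) F (𝓝 (A₀ * B₀)) := by
  refine tendsto_pi_nhds.mpr fun a => tendsto_pi_nhds.mpr fun b => ?_
  simp only [Matrix.mul_apply]
  exact tendsto_finsetSum _ fun c _ =>
    (tendsto_pi_nhds.mp (tendsto_pi_nhds.mp hA a) c).mul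
      (tendsto_pi_nhds.mp (tendsto_pi_nhds.mp hB c) b)

theorem tendsto_matrix_inv {α : Type*} [DecidableEq m] {F : Filter α} {A : α → Matrix m m ℂ}
    {A₀ : Matrix m m ℂ} (hA : Tendsto A F (𝓝 A₀)) (h : IsUnit A₀) :
    Tendsto (fun w => (A w)⁻¹) F (𝓝 A₀⁻¹) := by
  have hd : A₀.det ≠ 0 := ((isUnit_iff_isUnit_det _).mp h).ne_zero
  have h1 : Tendsto (fun w => (A w).det⁻¹) F (𝓝 A₀.det⁻¹) :=
    ((continuous_id.matrix_det.tendsto A₀).comp hA).inv₀ hd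
  have h2 : Tendsto (fun w => (A w).adjugate) F (𝓝 A₀.adjugate) :=
    (continuous_id.matrix_adjugate.tendsto A₀).comp hA
  simpa only [Matrix.inv_def, Ring.inverse_eq_inv'] using h1.smul h2

end Asymptotics

/-! ### Recovering the potential one matrix at a time -/

theorem tendsto_adjSol_mul (C : ℕ → Matrix (Fin m₁ ⊕ Fin m₂) (Fin m₁ ⊕ Fin m₂) ℂ) (n : ℕ)
    {Q : ℂ → Matrix (Fin m₁ ⊕ Fin m₂) (Fin m₁) ℂ} {M : Matrix (Fin m₁ ⊕ Fin m₂) (Fin m₁) ℂ}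
    (hQ : Tendsto Q (𝓝[≠] 0) (𝓝 M)) :
    Tendsto (fun w => adjSol C n (cayley w) * Q w) (𝓝[≠] 0) (𝓝 (adjSol C n Complex.I * M)) :=
  tendsto_matrix_mul (((continuous_adjSol C n).tendsto _).comp tendsto_cayley) hQ

/-- The value at `z = i` of the transformed parameter determines the first matrix of the
potential. -/
theorem first_potential_eq {n n' : ℕ}
    {C C' : ℕ → Matrix (Fin m₁ ⊕ Fin m₂) (Fin m₁ ⊕ Fin m₂) ℂ}
    (hC : IsPotential n C) (hC' : IsPotential n' C')
    {M M' : Matrix (Fin m₁ ⊕ Fin m₂) (Fin m₁) ℂ} (hM' : IsNonnegFrame M')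
    {A : Matrix (Fin m₁) (Fin m₁) ℂ}
    (h : adjSol C' (n' + 1) Complex.I * M' = adjSol C (n + 1) Complex.I * M * A) :
    C 0 = C' 0 := by
  have h0 := hC 0 (by omega)
  have h0' := hC' 0 (by omega)
  have hY := hM'.adjSol_mul (n := n' + 1) (C := C') fun k hk => hC' k (by omega)
  refine eq_of_common_frame h0.1 h0.2 h0'.1 h0'.2 hY ?_ ?_
  · rw [h, adjSol_I_succ h0.1]
    simp only [← Matrix.mul_assoc]
    rw [mul_one_add_mul_sig h0.2]
  · rw [adjSol_I_succ h0'.1]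
    simp only [← Matrix.mul_assoc]
    rw [mul_one_add_mul_sig h0'.2]

/-- As `C₀j` is an involution, `1 + iz C₀j` inverts the leading factor `1 - iz C₀j` up to the scalar
`1 + z²`. -/
theorem one_sub_mul_adjSol_succ {C : ℕ → Matrix (Fin m₁ ⊕ Fin m₂) (Fin m₁ ⊕ Fin m₂) ℂ}
    (hC : (C 0).PosDef) (hj : C 0 * sig m₁ m₂ * C 0 = sig m₁ m₂) (n : ℕ) (z : ℂ) :
    (1 + (Complex.I * z) • (C 0 * sig m₁ m₂)) * adjSol C (n + 1) z =
      (1 + z ^ 2) • adjSol (fun k => C (k + 1)) n z := by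
  have h : (1 + (Complex.I * z) • (C 0 * sig m₁ m₂)) *
      (1 + (-(Complex.I * z)) • (C 0 * sig m₁ m₂)) = (1 + z ^ 2) • 1 := by
    have h2 : (Complex.I * z) * (-(Complex.I * z)) = z ^ 2 := by
      linear_combination (-z ^ 2) * Complex.I_sq
    rw [add_mul, mul_add, mul_add, smul_mul_smul_comm, mul_sig_mul_self hj, h2]
    simp only [one_mul, mul_one]
    module
  rw [adjSol_succ hC, ← mul_assoc, h, smul_mul_assoc, one_mul]

theorem one_add_cayley_sq {w : ℂ} (hw : 1 + w ≠ 0) :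
    (1 + w) ^ 2 / 4 * (1 + cayley w ^ 2) = w := by
  unfold cayley
  rw [mul_pow, Complex.I_sq]
  field_simp
  ring

theorem isBigO_of_mul_pow {F : ℂ → ℂ} {n : ℕ}
    (h : (fun w => w * F w) =O[𝓝[≠] 0] fun w : ℂ => w ^ (n + 1)) :
    F =O[𝓝[≠] 0] fun w : ℂ => w ^ n := by
  have h2 := (Asymptotics.isBigO_refl (fun w : ℂ => w⁻¹) (𝓝[≠] 0)).mul h
  refine h2.congr' ?_ ?_ <;> filter_upwards [self_mem_nhdsWithin] with w hw
  · exact inv_mul_cancel_left₀ hw _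
  · rw [pow_succ', inv_mul_cancel_left₀ hw]

theorem tendsto_zero_of_isBigO_pow {F : ℂ → ℂ} {n : ℕ}
    (h : F =O[𝓝[≠] 0] fun w : ℂ => w ^ (n + 1)) : Tendsto F (𝓝[≠] 0) (𝓝 0) := by
  refine h.trans_tendsto ?_
  have : Tendsto (fun w : ℂ => w ^ (n + 1)) (𝓝 0) (𝓝 (0 ^ (n + 1))) :=
    (continuous_pow (n + 1)).tendsto 0
  rw [zero_pow n.succ_ne_zero] at this
  exact this.mono_left nhdsWithin_le_nhds

theorem first_potential_eq_of_isBigO {r r' p : ℕ}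
    {C C' : ℕ → Matrix (Fin m₁ ⊕ Fin m₂) (Fin m₁ ⊕ Fin m₂) ℂ}
    (hC : IsPotential r C) (hC' : IsPotential r' C')
    {Q Q' : ℂ → Matrix (Fin m₁ ⊕ Fin m₂) (Fin m₁) ℂ}
    {M M' : Matrix (Fin m₁ ⊕ Fin m₂) (Fin m₁) ℂ} (hM' : IsNonnegFrame M')
    (hQ : Tendsto Q (𝓝[≠] 0) (𝓝 M)) (hQ' : Tendsto Q' (𝓝[≠] 0) (𝓝 M'))
    {A : ℂ → Matrix (Fin m₁) (Fin m₁) ℂ} {A₀ : Matrix (Fin m₁) (Fin m₁) ℂ}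
    (hA : Tendsto A (𝓝[≠] 0) (𝓝 A₀))
    (hO : ∀ a b, (fun w => (adjSol C' (r' + 1) (cayley w) * Q' w -
      adjSol C (r + 1) (cayley w) * Q w * A w) a b) =O[𝓝[≠] 0] fun w : ℂ => w ^ (p + 1)) :
    C 0 = C' 0 := by
  refine first_potential_eq hC hC' hM' (M := M) (A := A₀) ?_
  have h1 := (tendsto_adjSol_mul C' (r' + 1) hQ').sub
    (tendsto_matrix_mul (tendsto_adjSol_mul C (r + 1) hQ) hA)
  have h2 : Tendsto (fun w => adjSol C' (r' + 1) (cayley w) * Q' w -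
      adjSol C (r + 1) (cayley w) * Q w * A w) (𝓝[≠] 0) (𝓝 0) :=
    tendsto_pi_nhds.mpr fun a => tendsto_pi_nhds.mpr fun b => tendsto_zero_of_isBigO_pow (hO a b)
  exact sub_eq_zero.mp (tendsto_nhds_unique h1 h2)

/-- If the transformed parameters of two systems span the same subspaces up to `O(w ^ (p + 1))`
near `z = i`, then the potentials agree on `0 ≤ k ≤ p`. -/
theorem potential_eq_of_isBigO (p : ℕ) : ∀ {r r' : ℕ}, p ≤ r → p ≤ r' →
    ∀ {C C' : ℕ → Matrix (Fin m₁ ⊕ Fin m₂) (Fin m₁ ⊕ Fin m₂) ℂ},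
    IsPotential r C → IsPotential r' C' →
    ∀ {Q Q' : ℂ → Matrix (Fin m₁ ⊕ Fin m₂) (Fin m₁) ℂ}
      {M M' : Matrix (Fin m₁ ⊕ Fin m₂) (Fin m₁) ℂ}, IsNonnegFrame M' →
    Tendsto Q (𝓝[≠] 0) (𝓝 M) → Tendsto Q' (𝓝[≠] 0) (𝓝 M') →
    ∀ {A : ℂ → Matrix (Fin m₁) (Fin m₁) ℂ} {A₀ : Matrix (Fin m₁) (Fin m₁) ℂ},
    Tendsto A (𝓝[≠] 0) (𝓝 A₀) →
    (∀ a b, (fun w => (adjSol C' (r' + 1) (cayley w) * Q' w -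
      adjSol C (r + 1) (cayley w) * Q w * A w) a b) =O[𝓝[≠] 0] fun w : ℂ => w ^ (p + 1)) →
    ∀ k ≤ p, C k = C' k := by
  induction p with
  | zero =>
    intro r r' _ _ C C' hC hC' Q Q' M M' hM' hQ hQ' A A₀ hA hO k hk
    obtain rfl : k = 0 := by omega
    exact first_potential_eq_of_isBigO hC hC' hM' hQ hQ' hA hO
  | succ p ih =>
    intro r r' hr hr' C C' hC hC' Q Q' M M' hM' hQ hQ' A A₀ hA hO
    have hzero := first_potential_eq_of_isBigO hC hC' hM' hQ hQ' hA hO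
    obtain ⟨r, rfl⟩ : ∃ s, r = s + 1 := ⟨r - 1, by omega⟩
    obtain ⟨r', rfl⟩ : ∃ s, r' = s + 1 := ⟨r' - 1, by omega⟩
    have h0 := hC 0 (by omega)
    have h0' := hC' 0 (by omega)
    -- The scalar `(1 + w)² / 4` normalizes `1 + z² = 4w / (1 + w)²` to exactly `w`.
    have hG : Tendsto (fun w => ((1 + w) ^ 2 / 4) •
        (1 + (Complex.I * cayley w) • (C 0 * sig m₁ m₂))) (𝓝[≠] 0)
        (𝓝 (((1 + 0) ^ 2 / 4 : ℂ) • (1 + (Complex.I * Complex.I) • (C 0 * sig m₁ m₂)))) := by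
      have h1 : Tendsto (fun w : ℂ => (1 + w) ^ 2 / 4) (𝓝[≠] 0) (𝓝 ((1 + 0) ^ 2 / 4)) := by
        have : Continuous fun w : ℂ => (1 + w) ^ 2 / 4 := by fun_prop
        exact (this.tendsto 0).mono_left nhdsWithin_le_nhds
      have h2 : Continuous fun z : ℂ => 1 + (Complex.I * z) • (C 0 * sig m₁ m₂) := by fun_prop
      exact h1.smul ((h2.tendsto _).comp tendsto_cayley)
    have htail := ih (by omega) (by omega) hC.tail hC'.tail hM' hQ hQ' hA fun a b => by
      refine isBigO_of_mul_pow ((isBigO_mul_of_tendsto_left hG hO a b).congr' ?_ .rfl)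
      filter_upwards [nhdsWithin_le_nhds one_add_ne_zero_eventually] with w hw
      have e : (((1 + w) ^ 2 / 4) • (1 + (Complex.I * cayley w) • (C 0 * sig m₁ m₂))) *
          (adjSol C' (r' + 1 + 1) (cayley w) * Q' w -
            adjSol C (r + 1 + 1) (cayley w) * Q w * A w) =
          w • (adjSol (fun k => C' (k + 1)) (r' + 1) (cayley w) * Q' w -
            adjSol (fun k => C (k + 1)) (r + 1) (cayley w) * Q w * A w) := by
        rw [Matrix.mul_sub, Matrix.smul_mul, Matrix.smul_mul]
        simp only [← Matrix.mul_assoc]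
        -- The same left multiplier strips the primed system too, because `C₀ = C'₀` is already
        -- known.
        rw [one_sub_mul_adjSol_succ h0.1 h0.2, hzero, one_sub_mul_adjSol_succ h0'.1 h0'.2]
        simp only [Matrix.smul_mul, smul_smul, one_add_cayley_sq hw, smul_sub]
      rw [e, Matrix.smul_apply, smul_eq_mul]
    intro k hk
    cases k with
    | zero => exact hzero
    | succ k => exact htail k (by omega)

/-! ### From Weyl functions to frames at `z = i` -/

theorem eventually_nhdsNE_I {q : ℂ → Prop} (h : ∀ᶠ z in codiscreteWithin upperHalf, q z) :
    ∀ᶠ z in 𝓝[≠] Complex.I, q z := by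
  have hI : upperHalf ∈ 𝓝 Complex.I :=
    (isOpen_lt continuous_const Complex.continuous_im).mem_nhds (by simp)
  filter_upwards [mem_codiscreteWithin_iff_forall_mem_nhdsNE.mp h Complex.I (mem_of_mem_nhds hI),
    nhdsWithin_le_nhds hI] with z hz hz'
  exact hz.resolve_right fun hn => hn hz'

theorem IsParameter.tendsto_I {P : ℂ → Matrix (Fin m₁ ⊕ Fin m₂) (Fin m₁) ℂ}
    (hP : IsParameter P) : Tendsto P (𝓝[≠] Complex.I) (𝓝 (P Complex.I)) :=
  tendsto_pi_nhds.mpr fun a => tendsto_pi_nhds.mpr fun b =>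
    (hP.analyticAt_I a b).continuousAt.tendsto.mono_left nhdsWithin_le_nhds

theorem IsParameter.isNonnegFrame {P : ℂ → Matrix (Fin m₁ ⊕ Fin m₂) (Fin m₁) ℂ}
    (hP : IsParameter P) : IsNonnegFrame (P Complex.I) := by
  have hj : ∀ᶠ z in 𝓝[≠] Complex.I, ((P z)ᴴ * sig m₁ m₂ * P z).PosSemidef :=
    eventually_nhdsNE_I hP.property_j
  intro x hx
  refine ⟨fun h => ?_, ?_⟩
  · have h1 := hP.nonsingular_I.dotProduct_mulVec_pos hx
    rw [← mulVec_mulVec, h, mulVec_zero, dotProduct_zero] at h1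
    exact h1.false
  · have hc : Continuous fun N : Matrix (Fin m₁ ⊕ Fin m₂) (Fin m₁) ℂ =>
        star (N *ᵥ x) ⬝ᵥ (sig m₁ m₂ *ᵥ (N *ᵥ x)) := by
      have hN : Continuous fun N : Matrix (Fin m₁ ⊕ Fin m₂) (Fin m₁) ℂ => N *ᵥ x :=
        continuous_id.matrix_mulVec continuous_const
      exact hN.star.dotProduct (continuous_const.matrix_mulVec hN)
    -- Property-`j` may fail at the point `i` of the exceptional set, so nonnegativity there comes
    -- from the punctured limit.
    refine ge_of_tendsto ((hc.tendsto _).comp hP.tendsto_I) ?_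
    filter_upwards [hj] with z hz
    have h1 := hz.dotProduct_mulVec_nonneg x
    rwa [Matrix.mul_assoc, ← mulVec_mulVec, ← mulVec_mulVec, dotProduct_mulVec,
      ← star_mulVec] at h1

/-- Two matrices with invertible upper blocks differ, up to a right factor, by the difference of
their graph parametrizations. -/
theorem sub_mul_eq_fromRows_mul {Y Y' : Matrix (Fin m₁ ⊕ Fin m₂) (Fin m₁) ℂ}
    (hY : IsUnit Y.toRows₁) (hY' : IsUnit Y'.toRows₁) :
    Y' - Y * (Y.toRows₁⁻¹ * Y'.toRows₁) =
      fromRows (0 : Matrix (Fin m₁) (Fin m₁) ℂ)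
        (-(Y.toRows₂ * Y.toRows₁⁻¹) - -(Y'.toRows₂ * Y'.toRows₁⁻¹)) * Y'.toRows₁ := by
  have hd := (isUnit_iff_isUnit_det _).mp hY
  have hd' := (isUnit_iff_isUnit_det _).mp hY'
  have htop : (Y * (Y.toRows₁⁻¹ * Y'.toRows₁)).toRows₁ = Y'.toRows₁ :=
    mul_nonsing_inv_cancel_left _ _ hd
  have hbot : (-(Y.toRows₂ * Y.toRows₁⁻¹) - -(Y'.toRows₂ * Y'.toRows₁⁻¹)) * Y'.toRows₁ =
      Y'.toRows₂ - (Y * (Y.toRows₁⁻¹ * Y'.toRows₁)).toRows₂ := by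
    have h : (Y * (Y.toRows₁⁻¹ * Y'.toRows₁)).toRows₂ = Y.toRows₂ * (Y.toRows₁⁻¹ * Y'.toRows₁) :=
      rfl
    rw [h, Matrix.sub_mul, Matrix.neg_mul, Matrix.neg_mul, nonsing_inv_mul_cancel_right _ _ hd',
      Matrix.mul_assoc]
    abel
  rw [fromRows_mul, Matrix.zero_mul, hbot]
  refine Matrix.ext fun a b => ?_
  rcases a with a | a
  · exact sub_eq_zero.mpr (congrFun (congrFun htop a) b).symm
  · rfl

theorem IsParameter.tendsto_toRows₁ {P : ℂ → Matrix (Fin m₁ ⊕ Fin m₂) (Fin m₁) ℂ}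
    (hP : IsParameter P) {r : ℕ} {C : ℕ → Matrix (Fin m₁ ⊕ Fin m₂) (Fin m₁ ⊕ Fin m₂) ℂ}
    (hC : IsPotential r C) :
    Tendsto (fun w => (adjSol C (r + 1) (cayley w) * P (cayley w)).toRows₁) (𝓝[≠] 0)
        (𝓝 (adjSol C (r + 1) Complex.I * P Complex.I).toRows₁) ∧
      (∀ᶠ w in 𝓝[≠] 0, IsUnit (adjSol C (r + 1) (cayley w) * P (cayley w)).toRows₁) ∧
      IsUnit (adjSol C (r + 1) Complex.I * P Complex.I).toRows₁ := by
  have hu := (hP.isNonnegFrame.adjSol_mul (n := r + 1) (C := C)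
    fun k hk => hC k (by omega)).isUnit_toRows₁
  have hY := tendsto_adjSol_mul C (r + 1) (hP.tendsto_I.comp tendsto_cayley_nhdsNE)
  have hT : Tendsto (fun w => (adjSol C (r + 1) (cayley w) * P (cayley w)).toRows₁) (𝓝[≠] 0)
      (𝓝 (adjSol C (r + 1) Complex.I * P Complex.I).toRows₁) :=
    tendsto_pi_nhds.mpr fun a => tendsto_pi_nhds.mpr fun b =>
      tendsto_pi_nhds.mp (tendsto_pi_nhds.mp hY (Sum.inl a)) b
  refine ⟨hT, ?_, hu⟩
  have hd : Tendsto (fun w => (adjSol C (r + 1) (cayley w) * P (cayley w)).toRows₁.det) (𝓝[≠] 0)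
      (𝓝 (adjSol C (r + 1) Complex.I * P Complex.I).toRows₁.det) :=
    (continuous_id.matrix_det.tendsto _).comp hT
  filter_upwards [hd.eventually_ne ((isUnit_iff_isUnit_det _).mp hu).ne_zero] with w hw
  exact (isUnit_iff_isUnit_det _).mpr hw.isUnit

end DiscreteDirac

theorem corollary4p5 (m₁ m₂ : ℕ) (hm₁ : m₁ ≠ 0) (hm₂ : m₂ ≠ 0) (r r' p : ℕ)
    (C C' : ℕ → Matrix (Fin m₁ ⊕ Fin m₂) (Fin m₁ ⊕ Fin m₂) ℂ)
    (hC : DiscreteDirac.IsPotential r C) (hC' : DiscreteDirac.IsPotential r' C')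
    (φ φ' : ℂ → Matrix (Fin m₂) (Fin m₁) ℂ)
    (hφ : DiscreteDirac.IsWeylFunction r C φ) (hφ' : DiscreteDirac.IsWeylFunction r' C' φ')
    (hp : p ≤ min r r')
    (hO : ∀ a b,
      (fun z : ℂ => φ (Complex.I * ((1 - z) / (1 + z))) a b
          - φ' (Complex.I * ((1 - z) / (1 + z))) a b)
        =O[𝓝[≠] 0] fun z : ℂ => z ^ (p + 1)) :
    ∀ k ≤ p, C k = C' k := by
  obtain ⟨P, hP, hφP⟩ := hφ
  obtain ⟨P', hP', hφP'⟩ := hφ'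
  obtain ⟨hT, hTu, hTu₀⟩ := DiscreteDirac.IsParameter.tendsto_toRows₁ hP hC
  obtain ⟨hT', hTu', -⟩ := DiscreteDirac.IsParameter.tendsto_toRows₁ hP' hC'
  -- The right factor is `A = Y₁⁻¹ Y₁'`, with `Y₁`, `Y₁'` the upper blocks: it makes the upper block
  -- of `Y' - Y A` vanish and turns the lower one into `(φ - φ') Y₁'`.
  refine DiscreteDirac.potential_eq_of_isBigO p (by omega) (by omega) hC hC' hP'.isNonnegFrame
    (hP.tendsto_I.comp DiscreteDirac.tendsto_cayley_nhdsNE)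
    (hP'.tendsto_I.comp DiscreteDirac.tendsto_cayley_nhdsNE)
    (DiscreteDirac.tendsto_matrix_mul (DiscreteDirac.tendsto_matrix_inv hT hTu₀) hT') ?_
  have hE : ∀ a b, (fun w => (Matrix.fromRows (0 : Matrix (Fin m₁) (Fin m₁) ℂ)
      (φ (DiscreteDirac.cayley w) - φ' (DiscreteDirac.cayley w))) a b) =O[𝓝[≠] 0]
      fun w : ℂ => w ^ (p + 1) := by
    rintro (a | a) b
    · exact Asymptotics.isBigO_zero _ _
    · exact hO a b
  intro a b
  refine (DiscreteDirac.isBigO_mul_of_tendsto_right hT' hE a b).congr' ?_ .rfl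
  filter_upwards [hTu, hTu',
    DiscreteDirac.tendsto_cayley_nhdsNE.eventually (DiscreteDirac.eventually_nhdsNE_I hφP),
    DiscreteDirac.tendsto_cayley_nhdsNE.eventually (DiscreteDirac.eventually_nhdsNE_I hφP')]
    with w hu hu' h h'
  rw [h, h']
  exact congrFun (congrFun (DiscreteDirac.sub_mul_eq_fromRows_mul hu hu').symm a) b
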